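/- Let $G$ be a connected simple graph on $[n]$ and $R=\mathbb{C}[x_1,\dots,x_n,y_1,\dots,y_n]$ with its standard grading. Put $f_{i,j}=x_iy_j-x_jy_i$, and let $J_G=(f_{i,j} : \{i,j\}\in E(G),\ i<j)$ be the binomial edge ideal of $G$. For $W\subseteq[n]$ let $G_W$ be the induced subgraph on $W$. For $\mathcal S\subseteq[n]$ let $G_1,\dots,G_c$ be the connected components of $G_{[n]\setminus\mathcal S}$. Put $$P_{\mathcal S}=(x_i,y_i : i\in\mathcal S)+J_{\widetilde G_1}+\dots+J_{\widetilde G_c},$$ where $\widetilde G_i$ is the complete graph on $V(G_i)$, and let $$\mathcal D(M(\mathcal S))=\{B\subseteq[n] : B\cap\mathcal S\neq\emptyset\}\cup\bigcup_{i=1}^{c}\{B\subseteq[n] : |B\cap V(G_i)|\ge 2\}\cup\{B\subseteq[n] : |B|\ge 3\}.$$ A nonempty set $\mathcal S\subsetneq[n]$ is a minimal $k$-cut if $G_{[n]\setminus\mathcal S}$ has exactly $k$ connected components and, for each $i\in\mathcal S$, the graph $G_{([n]\setminus\mathcal S)\cup\{i\}}$ has fewer connected components than $G_{[n]\setminus\mathcal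 S}$. Let $\min(G)$ consist of $\emptyset$ and all minimal $k$-cuts of $G$ with $k\ge 2$. Fix $\mathcal S\in\min(G)$, and let $$\Delta_{\mathcal S}=\{\mathcal D(M(\mathcal S'))\setminus\mathcal D(M(\mathcal S)) : \mathcal S'\in\min(G)\setminus\{\mathcal S\}\},$$ a family of sets whose members are one- and two-element subsets of $[n]$. Let $\mathcal T(\mathcal S)$ be the set of transversals of $\Delta_{\mathcal S}$, that is, of the sets $A\subseteq\bigcup_{e\in\Delta_{\mathcal S}}e$ with $A\cap e\ne\emptyset$ for all $e\in\Delta_{\mathcal S}$. For $A\in\mathcal T(\mathcal S)$ let $A_1$ be the set of its one-element members, viewed as a subset of $[n]$, and $A_2$ the set of its two-element members. Let $J_{\mathcal T(\mathcal S)}$ be the ideal of $R$ generated by the polynomials $$g_{A,C,D}=\prod_{k\in C}x_k\prod_{k\in D}y_k\prod_{\{i,j\}\in A_2,\ i<j}f_{i,j}$$ over all $A\in\mathcal T(\mathcal S)$ and all disjoint $C,D$ (possibly empty) with $C\cup D=A_1$. Finally, let $$\mathrm v_{P_{\mathcal S}}(J_G)=\min\{d\ge 0 : (J_G:h)=P_{\mathcal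 S}\text{ for some homogeneous } h\in R\text{ of degree } d\}.$$ **Theorem.** Let $G$ be a connected simple graph on $[n]$ and $\mathcal S\in\min(G)$. Then $\mathrm v_{P_{\mathcal S}}(J_G)$ is well defined, $\mathcal T(\mathcal S)$ is nonempty, and $$\mathrm v_{P_{\mathcal S}}(J_G)\le\min\{|A_1|+2|A_2| : A\in\mathcal T(\mathcal S)\}.$$ Moreover, equality holds if the ideal $J_G+J_{\mathcal T(\mathcal S)}$ is radical. -/

import Mathlib

open MvPolynomial

noncomputable section

namespace BinomialEdge

/-- The polynomial ring `ℂ[x_1, …, x_n, y_1, …, y_n]`. -/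
abbrev PolyRing (n : ℕ) : Type := MvPolynomial (Fin n ⊕ Fin n) ℂ

/-- The variable `x_i`. -/
def x {n : ℕ} (i : Fin n) : PolyRing n := X (Sum.inl i)

/-- The variable `y_i`. -/
def y {n : ℕ} (i : Fin n) : PolyRing n := X (Sum.inr i)

/-- The minor `f_{i,j} = x_i y_j - x_j y_i`. -/
def f {n : ℕ} (i j : Fin n) : PolyRing n := x i * y j - x j * y i

/-- The binomial edge ideal `J_G = (f_{i,j} : {i,j} ∈ E(G), i < j)`. -/
def edgeIdeal {n : ℕ} (G : SimpleGraph (Fin n)) : Ideal (PolyRing n) :=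
  Ideal.span {p | ∃ i j : Fin n, i < j ∧ G.Adj i j ∧ p = f i j}

/-- The connected components of the induced subgraph on `W`. -/
abbrev Component {n : ℕ} (G : SimpleGraph (Fin n)) (W : Finset (Fin n)) : Type :=
  (G.induce (W : Set (Fin n))).ConnectedComponent

/-- The vertex set of a connected component of the induced subgraph on `W`,
as a set of vertices of the ambient graph. -/
def componentVerts {n : ℕ} {G : SimpleGraph (Fin n)} {W : Finset (Fin n)}
    (K : Component G W) : Set (Fin n) :=
  Subtype.val '' K.supp

/-- The complete graph on the vertex set `U` (vertices outside `U` are isolated). -/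
def completeOn {n : ℕ} (U : Set (Fin n)) : SimpleGraph (Fin n) where
  Adj i j := i ≠ j ∧ i ∈ U ∧ j ∈ U
  symm := ⟨fun _ _ h => ⟨h.1.symm, h.2.2, h.2.1⟩⟩
  loopless := ⟨fun _ h => h.1 rfl⟩

/-- The ideal `P_S`, generated by the variables `x_i, y_i` with `i ∈ S` and by the binomial edge
ideals of the complete graphs on the vertex sets of the components of `G - S`. -/
def primeIdeal {n : ℕ} (G : SimpleGraph (Fin n)) (S : Finset (Fin n)) : Ideal (PolyRing n) :=
  Ideal.span {p | ∃ i ∈ S, p = x i ∨ p = y i} ⊔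
    ⨆ K : Component G Sᶜ, edgeIdeal (completeOn (componentVerts K))

/-- The number of connected components of the induced subgraph on `W`. -/
def numComponents {n : ℕ} (G : SimpleGraph (Fin n)) (W : Finset (Fin n)) : ℕ :=
  Nat.card (Component G W)

/-- `i` is a cut point of the induced subgraph `H` on `W`: `i` is a vertex of `H`, and `H` has fewer
connected components than `H - i`. -/
def IsCutPoint {n : ℕ} (G : SimpleGraph (Fin n)) (W : Finset (Fin n)) (i : Fin n) : Prop :=
  i ∈ W ∧ numComponents G W < numComponents G (W \ {i})

/-- `S` is a minimal `k`-cut of `G`. -/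
def IsMinimalCut {n : ℕ} (G : SimpleGraph (Fin n)) (k : ℕ) (S : Finset (Fin n)) : Prop :=
  S.Nonempty ∧ S ≠ Finset.univ ∧ numComponents G Sᶜ = k ∧ ∀ i ∈ S, IsCutPoint G (Sᶜ ∪ {i}) i

/-- `min(G)`: all minimal `k`-cuts of `G` with `k ≥ 2`, together with the empty set. -/
def minCuts {n : ℕ} (G : SimpleGraph (Fin n)) : Set (Finset (Fin n)) :=
  {S | ∃ k, 2 ≤ k ∧ IsMinimalCut G k S} ∪ {∅}

/-- `D(M(S))`: the dependent sets of the matroid `M(S)` of rank at most two attached to `S`. -/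
def dependentSets {n : ℕ} (G : SimpleGraph (Fin n)) (S : Finset (Fin n)) :
    Set (Finset (Fin n)) :=
  {B | (B ∩ S).Nonempty} ∪
    (⋃ K : Component G Sᶜ, {B | 2 ≤ ((B : Set (Fin n)) ∩ componentVerts K).ncard}) ∪
    {B | 3 ≤ B.card}

/-- The collection `Δ_S` of the sets `D(M(S')) \ D(M(S))` for `S' ∈ min(G)`, `S' ≠ S`. -/
def Delta {n : ℕ} (G : SimpleGraph (Fin n)) (S : Finset (Fin n)) :
    Set (Set (Finset (Fin n))) :=
  {e | ∃ S' ∈ minCuts G \ {S}, e = dependentSets G S' \ dependentSets G S}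

/-- `A` is a transversal of the collection `F`: it is contained in the union of the members of `F`,
and it meets every member of `F`. -/
def IsTransversal {E : Type*} (F : Set (Set E)) (A : Finset E) : Prop :=
  (A : Set E) ⊆ ⋃₀ F ∧ ∀ e ∈ F, ((A : Set E) ∩ e).Nonempty

/-- `T(S)`: the set of all transversals of `Δ_S`. -/
def transversals {n : ℕ} (G : SimpleGraph (Fin n)) (S : Finset (Fin n)) :
    Set (Finset (Finset (Fin n))) :=
  {A | IsTransversal (Delta G S) A}

/-- `A_1`: the one-element members of `A`, identified with a subset of the vertex set. -/
def part1 {n : ℕ} (A : Finset (Finset (Fin n))) : Finset (Fin n) :=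
  Finset.univ.filter fun i => {i} ∈ A

/-- `A_2`: the two-element members of `A`. -/
def part2 {n : ℕ} (A : Finset (Finset (Fin n))) : Finset (Finset (Fin n)) :=
  A.filter fun B => B.card = 2

/-- `g_{A,C,D} = ∏_{k ∈ C} x_k ∏_{k ∈ D} y_k ∏_{{i,j} ∈ A_2} f_{i,j}`; every pair `{i,j}` is
listed once, as `i < j`. -/
def g {n : ℕ} (A : Finset (Finset (Fin n))) (C D : Finset (Fin n)) : PolyRing n :=
  (∏ k ∈ C, x k) * (∏ k ∈ D, y k) *
    ∏ p ∈ (Finset.univ : Finset (Fin n × Fin n)).filter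
      (fun p => p.1 < p.2 ∧ {p.1, p.2} ∈ part2 A), f p.1 p.2

/-- The ideal `J_{T(S)}` generated by all `g_{A,C,D}` with `A ∈ T(S)` and `C ⨿ D = A_1`
(either of `C`, `D` may be empty). -/
def transversalIdeal {n : ℕ} (G : SimpleGraph (Fin n)) (S : Finset (Fin n)) :
    Ideal (PolyRing n) :=
  Ideal.span {p | ∃ A ∈ transversals G S, ∃ C D : Finset (Fin n),
    Disjoint C D ∧ C ∪ D = part1 A ∧ p = g A C D}

/-- The degrees of the homogeneous polynomials `h` with `(I : h) = P`. -/
def vDegrees {σ : Type*} (I P : Ideal (MvPolynomial σ ℂ)) : Set ℕ :=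
  {d | ∃ h : MvPolynomial σ ℂ, h.IsHomogeneous d ∧ I.colon {h} = P}

/-- The localized v-number `v_P(I)`, the least `d` such that `(I : h) = P` for some homogeneous
polynomial `h` of degree `d` (meaningful when there is such an `h`). -/
def vNumber {σ : Type*} (I P : Ideal (MvPolynomial σ ℂ)) : ℕ := sInf (vDegrees I P)

/-- The set of the numbers `|A_1| + 2 |A_2|` for `A ∈ T(S)`. -/
def transversalWeights {n : ℕ} (G : SimpleGraph (Fin n)) (S : Finset (Fin n)) : Set ℕ :=
  {w | ∃ A ∈ transversals G S, w = (part1 A).card + 2 * (part2 A).card}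

end BinomialEdge

end

/-!
The ideal `J_G` is radical and its minimal primes are the `P_S` with `S ∈ min(G)`
(`mem_edgeIdeal_iff`). Hence `(J_G : h) = P_S` exactly when `h` lies in all the other minimal
primes and not in `P_S` (`colon_edgeIdeal_eq_iff`). A variable or a minor lies in `P_S` if and only
if its index set is dependent in `M(S)`, so `g_{A,C,D}` has this property for every transversal `A`,
which gives the upper bound (`colon_g_eq`). Conversely, a prime containing `J_G + J_T` contains some
`P_{S'}` with `S' ≠ S` (`exists_primeIdeal_le_of_transversalIdeal_le`): otherwise each `P_{S'}` has
a generator outside the prime, and these generators form a transversal whose polynomial is outside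
it. So every `h` with `(J_G : h) = P_S` lies in the radical of `J_G + J_T`. If `J_G + J_T` is
radical, then `h ∈ J_G + J_T` and `h ∉ J_G`, and by homogeneity some generator of `J_T` has degree
at most that of `h`.

The decomposition of `J_G` is obtained without Gröbner bases, from ideals generated by variables
`x_i, y_i` with `i ∈ S` and minors `f_{i,j}` with `r i j`, for an arbitrary relation `r`
(`cutIdeal`). If `r` is an equivalence relation, such an ideal is the kernel of a monomial map
(`ker_toricMap`), hence prime; in particular the `P_S` are prime. If `r i v` and `r v j` but not
`r i j`, the ideal is the intersection of the one with the minor `f_{i,j}` adjoined and the one with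
`x_v, y_v` adjoined (`inf_cutIdeal_le`), so by induction all these ideals are finite intersections
of primes. Finally, a prime containing `J_G` contains `P_S` for the set `S` of vertices both of
whose variables it contains, and removing from `S` the vertices that are not cut points leads to a member
of `min(G)` with a smaller `P_S` (`exists_minCuts_primeIdeal_le`).
-/

noncomputable section

namespace BinomialEdge

variable {n : ℕ}

/-! ### Ideals generated by variables and minors -/

/-- The ideal generated by the variables `x_i, y_i` with `i ∈ S` and the minors `f_{i,j}` with
`r i j`. The relation may be asymmetric and may relate points of `S`; neither matters much, since
`f_{j,i} = -f_{i,j}` and minors meeting `S` are already in the ideal. -/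
def cutIdeal (S : Finset (Fin n)) (r : Fin n → Fin n → Prop) : Ideal (PolyRing n) :=
  Ideal.span ({p | ∃ i ∈ S, p = x i ∨ p = y i} ∪ {p | ∃ i j, r i j ∧ p = f i j})

lemma f_swap (i j : Fin n) : f j i = -f i j := by simp only [f]; ring

lemma x_mem_cutIdeal {S : Finset (Fin n)} {r : Fin n → Fin n → Prop} {i : Fin n} (hi : i ∈ S) :
    x i ∈ cutIdeal S r :=
  Ideal.subset_span (Or.inl ⟨i, hi, Or.inl rfl⟩)

lemma y_mem_cutIdeal {S : Finset (Fin n)} {r : Fin n → Fin n → Prop} {i : Fin n} (hi : i ∈ S) :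
    y i ∈ cutIdeal S r :=
  Ideal.subset_span (Or.inl ⟨i, hi, Or.inr rfl⟩)

lemma f_mem_cutIdeal {S : Finset (Fin n)} {r : Fin n → Fin n → Prop} {i j : Fin n} (h : r i j) :
    f i j ∈ cutIdeal S r :=
  Ideal.subset_span (Or.inr ⟨i, j, h, rfl⟩)

lemma f_mem_of_left {I : Ideal (PolyRing n)} {i : Fin n} (hx : x i ∈ I) (hy : y i ∈ I)
    (j : Fin n) : f i j ∈ I :=
  I.sub_mem (I.mul_mem_right _ hx) (I.mul_mem_left _ hy)

lemma f_mem_of_right {I : Ideal (PolyRing n)} {j : Fin n} (hx : x j ∈ I) (hy : y j ∈ I)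
    (i : Fin n) : f i j ∈ I :=
  I.sub_mem (I.mul_mem_left _ hy) (I.mul_mem_right _ hx)

lemma cutIdeal_le {S : Finset (Fin n)} {r : Fin n → Fin n → Prop} {I : Ideal (PolyRing n)} :
    cutIdeal S r ≤ I ↔
      (∀ i ∈ S, x i ∈ I ∧ y i ∈ I) ∧ ∀ i ∉ S, ∀ j ∉ S, r i j → f i j ∈ I := by
  refine ⟨fun h => ⟨fun i hi => ⟨h (x_mem_cutIdeal hi), h (y_mem_cutIdeal hi)⟩,
    fun i _ j _ hr => h (f_mem_cutIdeal hr)⟩, fun ⟨h1, h2⟩ => Ideal.span_le.2 ?_⟩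
  rintro p (⟨i, hi, rfl | rfl⟩ | ⟨i, j, hr, rfl⟩)
  · exact (h1 i hi).1
  · exact (h1 i hi).2
  · by_cases hi : i ∈ S
    · exact f_mem_of_left (h1 i hi).1 (h1 i hi).2 j
    by_cases hj : j ∈ S
    · exact f_mem_of_right (h1 j hj).1 (h1 j hj).2 i
    exact h2 i hi j hj hr

lemma cutIdeal_congr {S : Finset (Fin n)} {r r' : Fin n → Fin n → Prop}
    (h : ∀ i ∉ S, ∀ j ∉ S, (r i j ↔ r' i j)) : cutIdeal S r = cutIdeal S r' :=
  le_antisymm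
    (cutIdeal_le.2 ⟨fun _ hi => ⟨x_mem_cutIdeal hi, y_mem_cutIdeal hi⟩,
      fun i hi j hj hr => f_mem_cutIdeal ((h i hi j hj).1 hr)⟩)
    (cutIdeal_le.2 ⟨fun _ hi => ⟨x_mem_cutIdeal hi, y_mem_cutIdeal hi⟩,
      fun i hi j hj hr => f_mem_cutIdeal ((h i hi j hj).2 hr)⟩)

/-! ### Primality when the relation is an equivalence -/

section Toric

variable {ι : Type*}

open Classical in
/-- The monomial map `x_i ↦ t_i`, `y_i ↦ t_i s_{c(i)}`, which kills `x_i` and `y_i` for `i ∈ S`. -/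
def toricMap (S : Finset (Fin n)) (c : Fin n → ι) :
    PolyRing n →ₐ[ℂ] MvPolynomial (Fin n ⊕ ι) ℂ :=
  aeval (Sum.elim (fun i => if i ∈ S then 0 else X (Sum.inl i))
    (fun i => if i ∈ S then 0 else X (Sum.inl i) * X (Sum.inr (c i))))

lemma toricMap_x (S : Finset (Fin n)) (c : Fin n → ι) (i : Fin n) :
    toricMap S c (x i) = if i ∈ S then 0 else X (Sum.inl i) := by
  simp [toricMap, x]

lemma toricMap_y (S : Finset (Fin n)) (c : Fin n → ι) (i : Fin n) :
    toricMap S c (y i) = if i ∈ S then 0 else X (Sum.inl i) * X (Sum.inr (c i)) := by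
  simp [toricMap, y]

/-- The weight of a variable: the exponent of its image under the toric map with `S = ∅`. -/
def toricWeight (c : Fin n → ι) : Fin n ⊕ Fin n → (Fin n ⊕ ι →₀ ℕ) :=
  Sum.elim (fun i => Finsupp.single (Sum.inl i) 1)
    (fun i => Finsupp.single (Sum.inl i) 1 + Finsupp.single (Sum.inr (c i)) 1)

/-- The exponent of the image of a monomial under the toric map with `S = ∅`. -/
def toricExp (c : Fin n → ι) (m : Fin n ⊕ Fin n →₀ ℕ) : Fin n ⊕ ι →₀ ℕ :=
  m.sum fun v k => k • toricWeight c v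

lemma toricExp_eq (c : Fin n → ι) (m : Fin n ⊕ Fin n →₀ ℕ) :
    toricExp c m = ∑ i, m (Sum.inl i) • toricWeight c (Sum.inl i) +
      ∑ i, m (Sum.inr i) • toricWeight c (Sum.inr i) := by
  rw [toricExp, Finsupp.sum_fintype _ _ (by simp), Fintype.sum_sum_type]

lemma toricExp_inl (c : Fin n → ι) (m : Fin n ⊕ Fin n →₀ ℕ) (i : Fin n) :
    toricExp c m (Sum.inl i) = m (Sum.inl i) + m (Sum.inr i) := by
  classical
  simp [toricExp_eq, toricWeight, Finsupp.single_apply]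

open Classical in
lemma toricExp_inr (c : Fin n → ι) (m : Fin n ⊕ Fin n →₀ ℕ) (k : ι) :
    toricExp c m (Sum.inr k) = ∑ i with c i = k, m (Sum.inr i) := by
  simp [toricExp_eq, toricWeight, Finsupp.single_apply, Finset.sum_filter]

lemma toricExp_add (c : Fin n → ι) (m m' : Fin n ⊕ Fin n →₀ ℕ) :
    toricExp c (m + m') = toricExp c m + toricExp c m' := by
  simp [toricExp_eq, add_smul, Finset.sum_add_distrib]; abel

lemma toricExp_single (c : Fin n → ι) (v : Fin n ⊕ Fin n) :
    toricExp c (Finsupp.single v 1) = toricWeight c v := by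
  simp [toricExp]

/-- Monomials with the same toric image are congruent: as long as they differ, an exchange
`x_j y_i → x_i y_j` with `c i = c j` brings the first one closer to the second. The distance uses
truncated subtraction: it counts the excess of `y`-exponents of `m` over those of `m'`. -/
lemma monomial_sub_monomial_mem (S : Finset (Fin n)) (c : Fin n → ι) (N : ℕ) :
    ∀ m m' : Fin n ⊕ Fin n →₀ ℕ, toricExp c m = toricExp c m' →
      ∑ i, (m (Sum.inr i) - m' (Sum.inr i)) ≤ N →
      (monomial m 1 - monomial m' 1 : PolyRing n) ∈ cutIdeal S (fun i j => c i = c j) := by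
  classical
  induction N with
  | zero =>
    intro m m' he hN
    have hle : ∀ i ∈ Finset.univ, m (Sum.inr i) ≤ m' (Sum.inr i) := by
      intro i _
      have := Finset.sum_eq_zero_iff.1 (Nat.le_zero.1 hN) i (Finset.mem_univ i)
      omega
    have heq : ∀ i, m (Sum.inr i) = m' (Sum.inr i) := by
      intro i
      have h := DFunLike.congr_fun he (Sum.inr (c i))
      rw [toricExp_inr, toricExp_inr] at h
      exact (Finset.sum_eq_sum_iff_of_le (fun i _ => hle i (Finset.mem_univ i))).1 h i (by simp)
    have : m = m' := by
      ext (i | i)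
      · have h := DFunLike.congr_fun he (Sum.inl i)
        rw [toricExp_inl, toricExp_inl, heq i] at h
        omega
      · exact heq i
    simp [this]
  | succ N ih =>
    intro m m' he hN
    by_cases hex : ∃ i, m' (Sum.inr i) < m (Sum.inr i)
    swap
    · push Not at hex
      refine ih m m' he ?_
      rw [Finset.sum_eq_zero (fun i _ => Nat.sub_eq_zero_of_le (hex i))]
      exact Nat.zero_le _
    obtain ⟨i, hi⟩ := hex
    have hj : ∃ j, c j = c i ∧ m (Sum.inr j) < m' (Sum.inr j) := by
      by_contra hcon
      push Not at hcon
      have h := DFunLike.congr_fun he (Sum.inr (c i))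
      rw [toricExp_inr, toricExp_inr] at h
      have : ∑ j with c j = c i, m' (Sum.inr j) < ∑ j with c j = c i, m (Sum.inr j) :=
        Finset.sum_lt_sum (fun j hj => hcon j (by simpa using hj)) ⟨i, by simp, hi⟩
      omega
    obtain ⟨j, hcj, hj⟩ := hj
    have hij : i ≠ j := by rintro rfl; omega
    have hxj : 0 < m (Sum.inl j) := by
      have h := DFunLike.congr_fun he (Sum.inl j)
      rw [toricExp_inl, toricExp_inl] at h
      omega
    obtain ⟨m₀, hm₀⟩ : ∃ m₀, m = m₀ + (Finsupp.single (Sum.inl j) 1 +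
        Finsupp.single (Sum.inr i) 1) := by
      refine ⟨m - (Finsupp.single (Sum.inl j) 1 + Finsupp.single (Sum.inr i) 1),
        (tsub_add_cancel_of_le ?_).symm⟩
      intro v
      rcases v with v | v
      · by_cases hv : j = v
        · subst hv; simp; omega
        · simp [hv]
      · by_cases hv : i = v
        · subst hv; simp; omega
        · simp [hv]
    set m₁ := m₀ + (Finsupp.single (Sum.inl i) 1 + Finsupp.single (Sum.inr j) 1) with hm₁
    have he₁ : toricExp c m₁ = toricExp c m := by
      rw [hm₁, hm₀]
      simp only [toricExp_add, toricExp_single, toricWeight, Sum.elim_inl, Sum.elim_inr, hcj]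
      abel
    have hdist : ∑ k, (m₁ (Sum.inr k) - m' (Sum.inr k)) <
        ∑ k, (m (Sum.inr k) - m' (Sum.inr k)) := by
      have hval : ∀ k, m₁ (Sum.inr k) + (if i = k then 1 else 0) =
          m (Sum.inr k) + (if j = k then 1 else 0) := by
        intro k
        simp only [hm₁, hm₀, Finsupp.add_apply, Finsupp.single_apply, Sum.inr.injEq,
          reduceCtorEq, if_false]
        omega
      refine Finset.sum_lt_sum (fun k _ => ?_) ⟨i, Finset.mem_univ i, ?_⟩
      · have := hval k
        by_cases hk : j = k
        · subst hk
          rw [if_neg hij, if_pos rfl] at this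
          omega
        · rw [if_neg hk] at this
          omega
      · have := hval i
        rw [if_pos rfl, if_neg hij.symm] at this
        omega
    have h₁ := ih m₁ m' (he₁.trans he) (by omega)
    have h₂ : (monomial m 1 - monomial m₁ 1 : PolyRing n) ∈
        cutIdeal S (fun i j => c i = c j) := by
      have : (monomial m 1 - monomial m₁ 1 : PolyRing n) = monomial m₀ 1 * f j i := by
        rw [hm₁, hm₀, f, x, y, x, y]
        simp only [mul_sub, X, monomial_mul, mul_one]
      rw [this]
      exact Ideal.mul_mem_left _ _ (f_mem_cutIdeal hcj)
    simpa using Ideal.add_mem _ h₂ h₁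

lemma toricMap_monomial (S : Finset (Fin n)) (c : Fin n → ι) {m : Fin n ⊕ Fin n →₀ ℕ}
    (hm : ∀ i ∈ S, m (Sum.inl i) = 0 ∧ m (Sum.inr i) = 0) :
    toricMap S c (monomial m 1) = monomial (toricExp c m) 1 := by
  classical
  rw [toricMap, aeval_monomial, map_one, one_mul, toricExp, monomial_finsupp_sum_index, C_1,
    one_mul]
  refine Finsupp.prod_congr fun v hv => ?_
  rcases v with i | i
  · have hi : i ∉ S := fun h => Finsupp.mem_support_iff.1 hv (hm i h).1
    simp [toricWeight, hi, X, monomial_pow]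
  · have hi : i ∉ S := fun h => Finsupp.mem_support_iff.1 hv (hm i h).2
    simp [toricWeight, hi, X, monomial_pow, monomial_mul]

lemma cutIdeal_le_ker (S : Finset (Fin n)) (c : Fin n → ι) :
    cutIdeal S (fun i j => c i = c j) ≤ RingHom.ker (toricMap S c) := by
  refine cutIdeal_le.2 ⟨fun i hi => ?_, fun i hi j hj hc => ?_⟩
  · simp [RingHom.mem_ker, toricMap_x, toricMap_y, hi]
  · simp only [RingHom.mem_ker, f, map_sub, map_mul, toricMap_x, toricMap_y, hi, hj, if_false, hc]
    ring

lemma monomial_mem_cutIdeal {S : Finset (Fin n)} {r : Fin n → Fin n → Prop}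
    {m : Fin n ⊕ Fin n →₀ ℕ} (hm : ¬ ∀ i ∈ S, m (Sum.inl i) = 0 ∧ m (Sum.inr i) = 0) :
    (monomial m 1 : PolyRing n) ∈ cutIdeal S r := by
  classical
  have key : ∀ v, m v ≠ 0 → (X v : PolyRing n) ∈ cutIdeal S r →
      (monomial m 1 : PolyRing n) ∈ cutIdeal S r := by
    intro v hv hX
    refine Ideal.mem_of_dvd _ ?_ hX
    rw [X, monomial_dvd_monomial]
    simp [Finsupp.single_le_iff, Nat.one_le_iff_ne_zero, hv]
  push Not at hm
  obtain ⟨i, hi, h⟩ := hm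
  by_cases h0 : m (Sum.inl i) = 0
  · exact key _ (h h0) (y_mem_cutIdeal hi)
  · exact key _ h0 (x_mem_cutIdeal hi)

open Classical in
lemma ker_toricMap (S : Finset (Fin n)) (c : Fin n → ι) :
    RingHom.ker (toricMap S c) = cutIdeal S (fun i j => c i = c j) := by
  refine le_antisymm (fun p hp => ?_) (cutIdeal_le_ker S c)
  set I := cutIdeal S (fun i j => c i = c j) with hI
  let good : (Fin n ⊕ Fin n →₀ ℕ) → Prop :=
    fun m => ∀ i ∈ S, m (Sum.inl i) = 0 ∧ m (Sum.inr i) = 0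
  -- a linear section, on the image of the toric map, of the map that it induces on `R / I`
  let ψ : MvPolynomial (Fin n ⊕ ι) ℂ →ₗ[ℂ] PolyRing n ⧸ I :=
    (basisMonomials (Fin n ⊕ ι) ℂ).constr ℂ fun w =>
      if h : ∃ m, good m ∧ toricExp c m = w then Ideal.Quotient.mk I (monomial h.choose 1) else 0
  have hψ : ψ ∘ₗ (toricMap S c).toLinearMap = (Ideal.Quotient.mkₐ ℂ I).toLinearMap := by
    refine (basisMonomials (Fin n ⊕ Fin n) ℂ).ext fun m => ?_
    simp only [coe_basisMonomials, LinearMap.comp_apply, AlgHom.toLinearMap_apply,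
      Ideal.Quotient.mkₐ_eq_mk]
    by_cases hm : good m
    · have hex : ∃ m', good m' ∧ toricExp c m' = toricExp c m := ⟨m, hm, rfl⟩
      have h1 : ψ (monomial (toricExp c m) 1) =
          Ideal.Quotient.mk I (monomial hex.choose 1) := by
        have := (basisMonomials (Fin n ⊕ ι) ℂ).constr_basis ℂ (fun w =>
          if h : ∃ m, good m ∧ toricExp c m = w then
            Ideal.Quotient.mk I (monomial h.choose 1) else 0) (toricExp c m)
        rw [coe_basisMonomials, dif_pos hex] at this
        exact this
      rw [toricMap_monomial S c hm, h1, Ideal.Quotient.eq]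
      exact monomial_sub_monomial_mem S c _ _ _ hex.choose_spec.2 le_rfl
    · have h1 : (monomial m 1 : PolyRing n) ∈ I := monomial_mem_cutIdeal hm
      have h2 : toricMap S c (monomial m 1) = 0 := cutIdeal_le_ker S c h1
      rw [h2, map_zero, Ideal.Quotient.eq_zero_iff_mem.2 h1]
  have := LinearMap.congr_fun hψ p
  rw [LinearMap.comp_apply, AlgHom.toLinearMap_apply, RingHom.mem_ker.1 hp, map_zero] at this
  exact Ideal.Quotient.eq_zero_iff_mem.1 this.symm

lemma cutIdeal_isPrime (S : Finset (Fin n)) (c : Fin n → ι) :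
    (cutIdeal S (fun i j => c i = c j)).IsPrime := by
  rw [← ker_toricMap]
  exact RingHom.ker_isPrime _

lemma x_mem_cutIdeal_iff {S : Finset (Fin n)} {c : Fin n → ι} {i : Fin n} :
    x i ∈ cutIdeal S (fun i j => c i = c j) ↔ i ∈ S := by
  refine ⟨fun h => ?_, x_mem_cutIdeal⟩
  by_contra hi
  have := cutIdeal_le_ker S c h
  simp [RingHom.mem_ker, toricMap_x, hi] at this

lemma y_mem_cutIdeal_iff {S : Finset (Fin n)} {c : Fin n → ι} {i : Fin n} :
    y i ∈ cutIdeal S (fun i j => c i = c j) ↔ i ∈ S := by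
  refine ⟨fun h => ?_, y_mem_cutIdeal⟩
  by_contra hi
  have := cutIdeal_le_ker S c h
  simp [RingHom.mem_ker, toricMap_y, hi] at this

lemma f_mem_cutIdeal_iff {S : Finset (Fin n)} {c : Fin n → ι} {i j : Fin n} :
    f i j ∈ cutIdeal S (fun i j => c i = c j) ↔ i ∈ S ∨ j ∈ S ∨ c i = c j := by
  constructor
  · intro h
    by_contra! hcon
    obtain ⟨hi, hj, hc⟩ := hcon
    have := cutIdeal_le_ker S c h
    simp only [RingHom.mem_ker, f, map_sub, map_mul, toricMap_x, toricMap_y, hi, hj,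
      if_false] at this
    have h2 : (X (Sum.inl i) * X (Sum.inl j) : MvPolynomial (Fin n ⊕ ι) ℂ) *
        (X (Sum.inr (c j)) - X (Sum.inr (c i))) = 0 := by
      rw [← this]; ring
    have h3 : (X (Sum.inr (c j)) - X (Sum.inr (c i)) : MvPolynomial (Fin n ⊕ ι) ℂ) ≠ 0 := by
      rw [sub_ne_zero]
      intro h
      exact hc (Sum.inr_injective (X_injective h)).symm
    exact mul_ne_zero (mul_ne_zero (X_ne_zero _) (X_ne_zero _)) h3 h2
  · rintro (h | h | h)
    · exact f_mem_of_left (x_mem_cutIdeal h) (y_mem_cutIdeal h) j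
    · exact f_mem_of_right (x_mem_cutIdeal h) (y_mem_cutIdeal h) i
    · exact f_mem_cutIdeal h

end Toric

/-! ### Radicality of the ideals generated by variables and minors -/

/-- The endomorphism of the polynomial ring that sends `x_v` and `y_v` to `0`. -/
def killVertex (v : Fin n) : PolyRing n →ₐ[ℂ] PolyRing n :=
  aeval (Sum.elim (fun i => if i = v then 0 else x i) (fun i => if i = v then 0 else y i))

lemma killVertex_x (v i : Fin n) : killVertex v (x i) = if i = v then 0 else x i := by
  simp [killVertex, x]

lemma killVertex_y (v i : Fin n) : killVertex v (y i) = if i = v then 0 else y i := by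
  simp [killVertex, y]

lemma killVertex_f {v i j : Fin n} (hi : i ≠ v) (hj : j ≠ v) : killVertex v (f i j) = f i j := by
  simp [f, killVertex_x, killVertex_y, hi, hj]

lemma sub_killVertex_mem (v : Fin n) (p : PolyRing n) :
    p - killVertex v p ∈ Ideal.span {x v, y v} := by
  have hx : x v ∈ Ideal.span {x v, y v} := Ideal.subset_span (by simp)
  have hy : y v ∈ Ideal.span {x v, y v} := Ideal.subset_span (by simp)
  rw [← Ideal.Quotient.eq]
  change Ideal.Quotient.mkₐ ℂ (Ideal.span {x v, y v}) p =
    ((Ideal.Quotient.mkₐ ℂ (Ideal.span {x v, y v})).comp (killVertex v)) p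
  congr 1
  refine algHom_ext fun w => ?_
  rcases w with i | i
  · change Ideal.Quotient.mk _ (x i) = Ideal.Quotient.mk _ (killVertex v (x i))
    rw [killVertex_x]
    split_ifs with h
    · rw [h, map_zero, Ideal.Quotient.eq_zero_iff_mem.2 hx]
    · rfl
  · change Ideal.Quotient.mk _ (y i) = Ideal.Quotient.mk _ (killVertex v (y i))
    rw [killVertex_y]
    split_ifs with h
    · rw [h, map_zero, Ideal.Quotient.eq_zero_iff_mem.2 hy]
    · rfl

lemma killVertex_mem {S : Finset (Fin n)} {r : Fin n → Fin n → Prop} {v : Fin n} {p : PolyRing n}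
    (hp : p ∈ cutIdeal (insert v S) r) : killVertex v p ∈ cutIdeal S r := by
  suffices h : cutIdeal (insert v S) r ≤ (cutIdeal S r).comap (killVertex v) from h hp
  refine cutIdeal_le.2 ⟨fun i hi => ?_, fun i hi j hj hr => ?_⟩
  · simp only [Ideal.mem_comap, killVertex_x, killVertex_y]
    split_ifs with h
    · simp
    · have := Finset.mem_of_mem_insert_of_ne hi h
      exact ⟨x_mem_cutIdeal this, y_mem_cutIdeal this⟩
  · rw [Finset.mem_insert, not_or] at hi hj
    rw [Ideal.mem_comap, killVertex_f hi.1 hj.1]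
    exact f_mem_cutIdeal hr

/-- The decomposition behind radicality. If `i - v - j` is a path, then `x_v f_{i,j}` and
`y_v f_{i,j}` lie in the ideal, so a multiple of `f_{i,j}` may be taken free of `x_v` and `y_v`. -/
lemma inf_cutIdeal_le {S : Finset (Fin n)} {r r' : Fin n → Fin n → Prop} {i v j : Fin n}
    (hiv : r i v) (hvj : r v j) (hi : i ≠ v) (hj : j ≠ v)
    (hr' : ∀ a b, r' a b → r a b ∨ (a = i ∧ b = j) ∨ (a = j ∧ b = i)) :
    cutIdeal S r' ⊓ cutIdeal (insert v S) r ≤ cutIdeal S r := by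
  rintro p ⟨hp₁, hp₂⟩
  have hle : cutIdeal S r' ≤ cutIdeal S r ⊔ Ideal.span {f i j} := by
    refine cutIdeal_le.2 ⟨fun k hk => ⟨Ideal.mem_sup_left (x_mem_cutIdeal hk),
      Ideal.mem_sup_left (y_mem_cutIdeal hk)⟩, fun a _ b _ hab => ?_⟩
    rcases hr' a b hab with h | ⟨rfl, rfl⟩ | ⟨rfl, rfl⟩
    · exact Ideal.mem_sup_left (f_mem_cutIdeal h)
    · exact Ideal.mem_sup_right (Ideal.mem_span_singleton_self _)
    · rw [f_swap b a]
      exact Ideal.mem_sup_right (neg_mem (Ideal.mem_span_singleton_self _))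
  obtain ⟨a, ha, b, hb, rfl⟩ := Submodule.mem_sup.1 (hle hp₁)
  obtain ⟨q, rfl⟩ := Ideal.mem_span_singleton'.1 hb
  have hvf : Ideal.span {x v, y v} ≤ (cutIdeal S r).colon {f i j} := by
    refine Ideal.span_le.2 ?_
    rintro _ (rfl | rfl) <;> rw [SetLike.mem_coe, Submodule.mem_colon_singleton, smul_eq_mul]
    · have : x v * f i j = x i * f v j + x j * f i v := by simp only [f]; ring
      rw [this]
      exact add_mem (Ideal.mul_mem_left _ _ (f_mem_cutIdeal hvj))
        (Ideal.mul_mem_left _ _ (f_mem_cutIdeal hiv))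
    · have : y v * f i j = y i * f v j + y j * f i v := by simp only [f]; ring
      rw [this]
      exact add_mem (Ideal.mul_mem_left _ _ (f_mem_cutIdeal hvj))
        (Ideal.mul_mem_left _ _ (f_mem_cutIdeal hiv))
  have h₁ : (q - killVertex v q) * f i j ∈ cutIdeal S r :=
    Submodule.mem_colon_singleton.1 (hvf (sub_killVertex_mem v q))
  have ha' : a ∈ cutIdeal (insert v S) r :=
    (cutIdeal_le.2 ⟨fun k hk => ⟨x_mem_cutIdeal (Finset.mem_insert_of_mem hk),
      y_mem_cutIdeal (Finset.mem_insert_of_mem hk)⟩, fun _ _ _ _ h => f_mem_cutIdeal h⟩ :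
      cutIdeal S r ≤ cutIdeal (insert v S) r) ha
  have h₂ : killVertex v q * f i j ∈ cutIdeal S r := by
    have h := killVertex_mem (((cutIdeal (insert v S) r).add_mem_iff_right ha').1 hp₂)
    rwa [map_mul, killVertex_f hi hj] at h
  have : a + q * f i j = a + ((q - killVertex v q) * f i j + killVertex v q * f i j) := by ring
  rw [this]
  exact add_mem ha (add_mem h₁ h₂)

/-- Either the relation is an equivalence off `S` and the ideal is prime, or the ideal is an
intersection of two ideals of the same kind with more killed vertices or more minors. -/
lemma cutIdeal_isRadical_of_card_le (N : ℕ) : ∀ (S : Finset (Fin n)) (r : Fin n → Fin n → Prop),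
    (∀ a, r a a) → (∀ a b, r a b → r b a) →
    Sᶜ.card + {p : Fin n × Fin n | ¬ r p.1 p.2}.ncard ≤ N →
    (cutIdeal S r).IsRadical := by
  induction N with
  | zero =>
    intro S r hrefl hsymm hN
    have hS : ∀ i, i ∈ S := by
      have : Sᶜ = ∅ := Finset.card_eq_zero.1 (by omega)
      intro i
      simpa using congrArg (i ∈ ·) this
    have := cutIdeal_isPrime S (fun i : Fin n => i)
    rw [cutIdeal_congr (r' := r) fun i hi => absurd (hS i) hi] at this
    exact this.isRadical
  | succ N ih =>
    intro S r hrefl hsymm hN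
    by_cases h : ∃ i v j, v ∉ S ∧ r i v ∧ r v j ∧ ¬ r i j
    · obtain ⟨i, v, j, hv, hiv, hvj, hij⟩ := h
      have hi : i ≠ v := by rintro rfl; exact hij hvj
      have hj : j ≠ v := by rintro rfl; exact hij hiv
      let r' : Fin n → Fin n → Prop := fun a b => r a b ∨ (a = i ∧ b = j) ∨ (a = j ∧ b = i)
      have heq : cutIdeal S r = cutIdeal S r' ⊓ cutIdeal (insert v S) r := by
        refine le_antisymm (le_inf ?_ ?_) (inf_cutIdeal_le hiv hvj hi hj fun a b h => h)
        · exact cutIdeal_le.2 ⟨fun k hk => ⟨x_mem_cutIdeal hk, y_mem_cutIdeal hk⟩,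
            fun _ _ _ _ h => f_mem_cutIdeal (Or.inl h)⟩
        · exact cutIdeal_le.2 ⟨fun k hk => ⟨x_mem_cutIdeal (Finset.mem_insert_of_mem hk),
            y_mem_cutIdeal (Finset.mem_insert_of_mem hk)⟩, fun _ _ _ _ h => f_mem_cutIdeal h⟩
      rw [heq]
      refine Ideal.IsRadical.inf (ih S r' (fun a => Or.inl (hrefl a)) ?_ ?_)
        (ih (insert v S) r hrefl hsymm ?_)
      · rintro a b (h | h | h)
        · exact Or.inl (hsymm _ _ h)
        · exact Or.inr (Or.inr h.symm)
        · exact Or.inr (Or.inl h.symm)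
      · have : {p : Fin n × Fin n | ¬ r' p.1 p.2}.ncard <
            {p : Fin n × Fin n | ¬ r p.1 p.2}.ncard := by
          refine Set.ncard_lt_ncard ((Set.ssubset_iff_of_subset ?_).2 ⟨(i, j), hij, ?_⟩)
          · exact fun p hp h => hp (Or.inl h)
          · exact fun h => h (Or.inr (Or.inl ⟨rfl, rfl⟩))
        omega
      · have : (insert v S)ᶜ.card < Sᶜ.card := by
          refine Finset.card_lt_card (Finset.compl_ssubset_compl.2 (Finset.ssubset_insert hv))
        omega
    · push Not at h
      let s : Setoid (Fin n) :=
        { r := fun a b => (a ∈ S ∧ b ∈ S) ∨ (a ∉ S ∧ b ∉ S ∧ r a b)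
          iseqv := by
            refine ⟨fun a => ?_, ?_, ?_⟩
            · by_cases ha : a ∈ S
              · exact Or.inl ⟨ha, ha⟩
              · exact Or.inr ⟨ha, ha, hrefl a⟩
            · rintro a b (h | ⟨ha, hb, h⟩)
              · exact Or.inl h.symm
              · exact Or.inr ⟨hb, ha, hsymm _ _ h⟩
            · rintro a b d (⟨ha, hb⟩ | ⟨ha, hb, h₁⟩) (⟨hb', hd⟩ | ⟨hb', hd, h₂⟩)
              · exact Or.inl ⟨ha, hd⟩
              · exact absurd hb hb'
              · exact absurd hb' hb
              · exact Or.inr ⟨ha, hd, h a b d hb h₁ h₂⟩ }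
      have := cutIdeal_isPrime S (fun i : Fin n => (Quotient.mk s i))
      rw [cutIdeal_congr (r' := r)] at this
      · exact this.isRadical
      · intro a ha b hb
        rw [Quotient.eq]
        change ((a ∈ S ∧ b ∈ S) ∨ (a ∉ S ∧ b ∉ S ∧ r a b)) ↔ r a b
        simp [ha, hb]

lemma edgeIdeal_eq_cutIdeal (G : SimpleGraph (Fin n)) :
    edgeIdeal G = cutIdeal ∅ (fun a b => a = b ∨ G.Adj a b) := by
  refine le_antisymm (Ideal.span_le.2 ?_) (cutIdeal_le.2 ⟨by simp, fun i _ j _ h => ?_⟩)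
  · rintro _ ⟨i, j, -, h, rfl⟩
    exact f_mem_cutIdeal (Or.inr h)
  · rcases h with rfl | h
    · simp [f]
    · rcases lt_or_gt_of_ne h.ne with hlt | hlt
      · exact Ideal.subset_span ⟨i, j, hlt, h, rfl⟩
      · rw [f_swap]
        exact neg_mem (Ideal.subset_span ⟨j, i, hlt, h.symm, rfl⟩)

/-- Binomial edge ideals are radical. -/
theorem edgeIdeal_isRadical (G : SimpleGraph (Fin n)) : (edgeIdeal G).IsRadical := by
  rw [edgeIdeal_eq_cutIdeal]
  refine cutIdeal_isRadical_of_card_le _ _ _ (fun a => Or.inl rfl) ?_ le_rfl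
  rintro a b (h | h)
  · exact Or.inl h.symm
  · exact Or.inr h.symm

/-! ### Connectivity in induced subgraphs -/

/-- `i` and `j` lie in a common connected component of the induced subgraph on `W`; in particular
both lie in `W`. -/
def Linked (G : SimpleGraph (Fin n)) (W : Finset (Fin n)) (i j : Fin n) : Prop :=
  ∃ K : Component G W, i ∈ componentVerts K ∧ j ∈ componentVerts K

lemma linked_iff_reachable {G : SimpleGraph (Fin n)} {W : Finset (Fin n)} {i j : Fin n} :
    Linked G W i j ↔ ∃ (hi : i ∈ (W : Set (Fin n))) (hj : j ∈ (W : Set (Fin n))),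
      (G.induce (W : Set (Fin n))).Reachable ⟨i, hi⟩ ⟨j, hj⟩ := by
  constructor
  · rintro ⟨K, ⟨a, ha, rfl⟩, ⟨b, hb, rfl⟩⟩
    refine ⟨a.2, b.2, ?_⟩
    rw [SimpleGraph.ConnectedComponent.mem_supp_iff] at ha hb
    exact SimpleGraph.ConnectedComponent.exact (ha.trans hb.symm)
  · rintro ⟨hi, hj, h⟩
    refine ⟨(G.induce (W : Set (Fin n))).connectedComponentMk ⟨i, hi⟩, ⟨⟨i, hi⟩, rfl, rfl⟩,
      ⟨⟨j, hj⟩, ?_, rfl⟩⟩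
    rw [SimpleGraph.ConnectedComponent.mem_supp_iff]
    exact SimpleGraph.ConnectedComponent.sound h.symm

variable {G : SimpleGraph (Fin n)} {W : Finset (Fin n)} {i j k : Fin n}

lemma Linked.left_mem (h : Linked G W i j) : i ∈ W := by
  obtain ⟨hi, -, -⟩ := linked_iff_reachable.1 h
  exact hi

lemma Linked.right_mem (h : Linked G W i j) : j ∈ W := by
  obtain ⟨-, hj, -⟩ := linked_iff_reachable.1 h
  exact hj

lemma Linked.symm (h : Linked G W i j) : Linked G W j i :=
  let ⟨K, hi, hj⟩ := h; ⟨K, hj, hi⟩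

lemma Linked.refl (hi : i ∈ W) : Linked G W i i :=
  linked_iff_reachable.2 ⟨hi, hi, SimpleGraph.Reachable.refl _⟩

lemma Linked.trans (h : Linked G W i j) (h' : Linked G W j k) : Linked G W i k := by
  obtain ⟨hi, hj, h⟩ := linked_iff_reachable.1 h
  obtain ⟨_, hk, h'⟩ := linked_iff_reachable.1 h'
  exact linked_iff_reachable.2 ⟨hi, hk, SimpleGraph.Reachable.trans h h'⟩

lemma Linked.of_adj (hi : i ∈ W) (hj : j ∈ W) (h : G.Adj i j) : Linked G W i j :=
  linked_iff_reachable.2 ⟨hi, hj, SimpleGraph.Adj.reachable (SimpleGraph.induce_adj.2 h)⟩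

/-- Induction along a walk that stays inside `W`. -/
lemma Linked.induction {motive : Fin n → Prop} (h : Linked G W i j) (base : motive i)
    (step : ∀ a ∈ W, ∀ b ∈ W, G.Adj a b → motive a → motive b) : motive j := by
  obtain ⟨hi, hj, h⟩ := linked_iff_reachable.1 h
  rw [SimpleGraph.reachable_iff_reflTransGen] at h
  have key : ∀ b : (W : Set (Fin n)),
      Relation.ReflTransGen (G.induce (W : Set (Fin n))).Adj ⟨i, hi⟩ b →
        Linked G W i b ∧ motive b := by
    intro b hb
    induction hb with
    | refl => exact ⟨Linked.refl hi, base⟩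
    | @tail b d _ hbd ih =>
      have hadj : G.Adj b d := hbd
      exact ⟨ih.1.trans (Linked.of_adj b.2 d.2 hadj), step b b.2 d d.2 hadj ih.2⟩
  exact (key _ h).2

/-- A vertex whose neighbours in `W` all lie in one component does not connect anything new. -/
lemma Linked.of_union_singleton
    (hnbr : ∀ a ∈ W, ∀ b ∈ W, G.Adj i a → G.Adj i b → Linked G W a b)
    (hj : j ∈ W) (hk : k ∈ W) (hi : i ∉ W) (h : Linked G (W ∪ {i}) j k) : Linked G W j k := by
  have key : (k ∈ W → Linked G W j k) ∧ (k = i → ∀ a ∈ W, G.Adj i a → Linked G W j a) := by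
    refine h.induction (motive := fun k => (k ∈ W → Linked G W j k) ∧
      (k = i → ∀ a ∈ W, G.Adj i a → Linked G W j a)) ⟨fun _ => Linked.refl hj, ?_⟩ ?_
    · rintro rfl
      exact absurd hj hi
    · intro a ha b hb hab ih
      rcases Finset.mem_union.1 ha with haW | hai
      · refine ⟨fun hbW => (ih.1 haW).trans (Linked.of_adj haW hbW hab), ?_⟩
        rintro rfl d hd hbd
        exact (ih.1 haW).trans (hnbr a haW d hd hab.symm hbd)
      · rw [Finset.mem_singleton] at hai
        subst hai
        exact ⟨fun hbW => ih.2 rfl b hbW hab, fun hba => absurd hba hab.ne'⟩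
  exact key.1 hk

/-- The map between components induced by an inclusion of vertex sets. -/
def componentMap (G : SimpleGraph (Fin n)) {W W' : Finset (Fin n)} (hW : W ⊆ W') :
    Component G W → Component G W' :=
  SimpleGraph.ConnectedComponent.map
    (SimpleGraph.induceHomOfLE G (Finset.coe_subset.2 hW)).toHom

lemma mk_eq_mk_iff_linked (hi : i ∈ W) (hj : j ∈ W) :
    (G.induce (W : Set (Fin n))).connectedComponentMk ⟨i, hi⟩ =
      (G.induce (W : Set (Fin n))).connectedComponentMk ⟨j, hj⟩ ↔ Linked G W i j := by
  rw [SimpleGraph.ConnectedComponent.eq, linked_iff_reachable]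
  exact ⟨fun h => ⟨hi, hj, h⟩, fun ⟨_, _, h⟩ => h⟩

lemma componentMap_mk {W' : Finset (Fin n)} (hW : W ⊆ W') (hi : i ∈ W) :
    componentMap G hW ((G.induce (W : Set (Fin n))).connectedComponentMk ⟨i, hi⟩) =
      (G.induce (W' : Set (Fin n))).connectedComponentMk ⟨i, hW hi⟩ := rfl

lemma compl_union_singleton_sdiff {S : Finset (Fin n)} (hi : i ∈ S) :
    (Sᶜ ∪ {i}) \ {i} = Sᶜ := by
  ext j
  by_cases h : j = i
  · simp [h, hi]
  · simp [h]

/-- Cut points are the vertices that have neighbours in two different components. -/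
lemma isCutPoint_iff {S : Finset (Fin n)} (hi : i ∈ S) :
    IsCutPoint G (Sᶜ ∪ {i}) i ↔
      ∃ a ∈ Sᶜ, ∃ b ∈ Sᶜ, G.Adj i a ∧ G.Adj i b ∧ ¬ Linked G Sᶜ a b := by
  have hiW : i ∉ Sᶜ := by simpa using hi
  have hsub : Sᶜ ⊆ Sᶜ ∪ {i} := Finset.subset_union_left
  rw [IsCutPoint, compl_union_singleton_sdiff hi, and_iff_right (by simp), numComponents,
    numComponents]
  constructor
  · intro hlt
    by_contra! hnbr
    refine absurd hlt (not_lt.2 (Nat.card_le_card_of_injective (componentMap G hsub) ?_))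
    intro K L
    refine SimpleGraph.ConnectedComponent.ind₂ ?_ K L
    rintro ⟨a, ha⟩ ⟨b, hb⟩ hab
    rw [componentMap_mk, componentMap_mk, mk_eq_mk_iff_linked] at hab
    exact (mk_eq_mk_iff_linked _ _).2 (Linked.of_union_singleton hnbr ha hb hiW hab)
  · rintro ⟨a, ha, b, hb, hia, hib, hab⟩
    have hi' : i ∈ Sᶜ ∪ {i} := by simp
    have hsurj : Function.Surjective (componentMap G hsub) := by
      refine SimpleGraph.ConnectedComponent.ind ?_
      rintro ⟨d, hd⟩
      rcases Finset.mem_union.1 hd with h | h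
      · exact ⟨_, componentMap_mk hsub h⟩
      · rw [Finset.mem_singleton] at h
        subst h
        refine ⟨_, (componentMap_mk hsub ha).trans ?_⟩
        exact (mk_eq_mk_iff_linked _ _).2 (Linked.of_adj (hsub ha) hd hia.symm)
    have hinj : ¬ Function.Injective (componentMap G hsub) := by
      intro hinj
      refine hab ((mk_eq_mk_iff_linked ha hb).1 (hinj ?_))
      rw [componentMap_mk, componentMap_mk, mk_eq_mk_iff_linked]
      exact (Linked.of_adj (hsub ha) hi' hia.symm).trans (Linked.of_adj hi' (hsub hb) hib)
    have := Fintype.ofFinite (Component G Sᶜ)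
    have := Fintype.ofFinite (Component G (Sᶜ ∪ {i}))
    rw [Nat.card_eq_fintype_card, Nat.card_eq_fintype_card]
    exact Fintype.card_lt_of_surjective_not_injective _ hsurj hinj

/-! ### The primes `P_S` and the dependent sets -/

/-- The vertices linked to a given vertex; empty for a vertex outside `W`. -/
def linkClass (G : SimpleGraph (Fin n)) (W : Finset (Fin n)) (i : Fin n) : Set (Fin n) :=
  {j | Linked G W i j}

lemma linkClass_eq_iff (hi : i ∈ W) : linkClass G W i = linkClass G W j ↔ Linked G W i j := by
  constructor
  · intro h
    have : i ∈ linkClass G W j := h ▸ Linked.refl hi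
    exact Linked.symm this
  · intro h
    ext k
    exact ⟨fun hk => h.symm.trans hk, fun hk => h.trans hk⟩

variable {S S' : Finset (Fin n)}

lemma primeIdeal_eq_cutIdeal_linked (G : SimpleGraph (Fin n)) (S : Finset (Fin n)) :
    primeIdeal G S = cutIdeal S (Linked G Sᶜ) := by
  refine le_antisymm (sup_le (Ideal.span_le.2 ?_) (iSup_le fun K => Ideal.span_le.2 ?_))
    (cutIdeal_le.2 ⟨fun i hi => ⟨?_, ?_⟩, ?_⟩)
  · rintro _ ⟨i, hi, rfl | rfl⟩
    · exact x_mem_cutIdeal hi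
    · exact y_mem_cutIdeal hi
  · rintro _ ⟨i, j, -, ⟨-, hi, hj⟩, rfl⟩
    exact f_mem_cutIdeal ⟨K, hi, hj⟩
  · exact Ideal.mem_sup_left (Ideal.subset_span ⟨i, hi, Or.inl rfl⟩)
  · exact Ideal.mem_sup_left (Ideal.subset_span ⟨i, hi, Or.inr rfl⟩)
  · rintro i - j - ⟨K, hi, hj⟩
    refine Ideal.mem_sup_right (Ideal.mem_iSup_of_mem K ?_)
    rcases lt_trichotomy i j with h | rfl | h
    · exact Ideal.subset_span ⟨i, j, h, ⟨h.ne, hi, hj⟩, rfl⟩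
    · simp [f]
    · rw [f_swap]
      exact neg_mem (Ideal.subset_span ⟨j, i, h, ⟨h.ne, hj, hi⟩, rfl⟩)

lemma primeIdeal_eq_cutIdeal (G : SimpleGraph (Fin n)) (S : Finset (Fin n)) :
    primeIdeal G S = cutIdeal S (fun a b => linkClass G Sᶜ a = linkClass G Sᶜ b) := by
  rw [primeIdeal_eq_cutIdeal_linked]
  exact cutIdeal_congr fun i hi j _ => (linkClass_eq_iff (by simpa using hi)).symm

lemma primeIdeal_isPrime (G : SimpleGraph (Fin n)) (S : Finset (Fin n)) :
    (primeIdeal G S).IsPrime := by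
  rw [primeIdeal_eq_cutIdeal]
  exact cutIdeal_isPrime S _

lemma x_mem_primeIdeal : x i ∈ primeIdeal G S ↔ i ∈ S := by
  rw [primeIdeal_eq_cutIdeal, x_mem_cutIdeal_iff]

lemma y_mem_primeIdeal : y i ∈ primeIdeal G S ↔ i ∈ S := by
  rw [primeIdeal_eq_cutIdeal, y_mem_cutIdeal_iff]

lemma f_mem_primeIdeal :
    f i j ∈ primeIdeal G S ↔ i ∈ S ∨ j ∈ S ∨ Linked G Sᶜ i j := by
  rw [primeIdeal_eq_cutIdeal, f_mem_cutIdeal_iff]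
  by_cases hi : i ∈ S
  · simp [hi]
  · rw [linkClass_eq_iff (by simpa using hi)]

lemma primeIdeal_le {I : Ideal (PolyRing n)} :
    primeIdeal G S ≤ I ↔ (∀ i ∈ S, x i ∈ I ∧ y i ∈ I) ∧ ∀ i j, Linked G Sᶜ i j → f i j ∈ I := by
  rw [primeIdeal_eq_cutIdeal_linked, cutIdeal_le]
  refine and_congr_right fun _ => ⟨fun h i j hij => h i ?_ j ?_ hij, fun h i _ j _ => h i j⟩
  · simpa using hij.left_mem
  · simpa using hij.right_mem

lemma edgeIdeal_le_primeIdeal (G : SimpleGraph (Fin n)) (S : Finset (Fin n)) :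
    edgeIdeal G ≤ primeIdeal G S := by
  refine Ideal.span_le.2 ?_
  rintro _ ⟨i, j, -, h, rfl⟩
  rw [SetLike.mem_coe, f_mem_primeIdeal]
  by_cases hi : i ∈ S
  · exact Or.inl hi
  by_cases hj : j ∈ S
  · exact Or.inr (Or.inl hj)
  exact Or.inr (Or.inr (Linked.of_adj (by simpa using hi) (by simpa using hj) h))

lemma singleton_mem_dependentSets : {i} ∈ dependentSets G S ↔ i ∈ S := by
  have h2 : ∀ K : Component G Sᶜ,
      ¬ 2 ≤ ((({i} : Finset (Fin n)) : Set (Fin n)) ∩ componentVerts K).ncard := by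
    intro K hK
    have := Set.ncard_le_ncard (Set.inter_subset_left (s := (({i} : Finset (Fin n)) : Set (Fin n)))
      (t := componentVerts K)) (Set.toFinite _)
    rw [Finset.coe_singleton, Set.ncard_singleton] at this
    rw [Finset.coe_singleton] at hK
    omega
  simp only [dependentSets, Set.mem_union, Set.mem_ofPred_eq, Set.mem_iUnion, h2, exists_false,
    Finset.card_singleton]
  simp [Finset.Nonempty]

lemma pair_mem_dependentSets (hij : i ≠ j) :
    {i, j} ∈ dependentSets G S ↔ i ∈ S ∨ j ∈ S ∨ Linked G Sᶜ i j := by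
  have h2 : ∀ K : Component G Sᶜ,
      2 ≤ ((({i, j} : Finset (Fin n)) : Set (Fin n)) ∩ componentVerts K).ncard ↔
        i ∈ componentVerts K ∧ j ∈ componentVerts K := by
    intro K
    rw [Finset.coe_pair]
    constructor
    · intro hK
      have heq : ({i, j} : Set (Fin n)) ∩ componentVerts K = {i, j} :=
        Set.eq_of_subset_of_ncard_le Set.inter_subset_left
          (by rw [Set.ncard_pair hij]; exact hK) (Set.toFinite _)
      have hsub := Set.inter_eq_left.1 heq
      exact ⟨hsub (by simp), hsub (by simp)⟩
    · rintro ⟨hi, hj⟩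
      rw [Set.inter_eq_left.2 (Set.insert_subset hi (Set.singleton_subset_iff.2 hj)),
        Set.ncard_pair hij]
  have hn : (({i, j} : Finset (Fin n)) ∩ S).Nonempty ↔ i ∈ S ∨ j ∈ S := by
    simp [Finset.Nonempty, or_and_right, exists_or]
  simp only [dependentSets, Set.mem_union, Set.mem_ofPred_eq, Set.mem_iUnion, h2, hn,
    Finset.card_pair hij, Linked]
  simp [or_assoc]

/-- Only one- and two-element sets distinguish the matroids `M(S)`. -/
lemma eq_singleton_or_pair_of_mem_sdiff {B : Finset (Fin n)}
    (hB : B ∈ dependentSets G S' \ dependentSets G S) :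
    (∃ i, B = {i}) ∨ ∃ i j, i < j ∧ B = {i, j} := by
  have h3 : B.card < 3 := by
    by_contra h
    exact hB.2 (Or.inr (not_lt.1 h))
  have h0 : B.card ≠ 0 := by
    intro h
    rw [Finset.card_eq_zero] at h
    subst h
    have := hB.1
    simp [dependentSets] at this
  obtain h | h : B.card = 1 ∨ B.card = 2 := by omega
  · exact Or.inl (Finset.card_eq_one.1 h)
  · obtain ⟨i, j, hij, rfl⟩ := Finset.card_eq_two.1 h
    rcases lt_or_gt_of_ne hij with hlt | hlt
    · exact Or.inr ⟨i, j, hlt, rfl⟩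
    · exact Or.inr ⟨j, i, hlt, Finset.pair_comm _ _⟩

lemma exists_separated_neighbours (hS : S ∈ minCuts G) (hi : i ∈ S) :
    ∃ a ∈ Sᶜ, ∃ b ∈ Sᶜ, G.Adj i a ∧ G.Adj i b ∧ ¬ Linked G Sᶜ a b := by
  rcases hS with ⟨k, -, -, -, -, h⟩ | h
  · exact (isCutPoint_iff hi).1 (h i hi)
  · rw [Set.mem_singleton_iff] at h
    subst h
    simp at hi

/-- Distinct members of `min(G)` have incomparable matroids. If `S' ⊊ S`, then a vertex of `S \ S'`
joins two components of `G - S` inside `G - S'`, so a pair across these components is dependent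
for `S'` and independent for `S`. -/
lemma sdiff_dependentSets_nonempty (hS : S ∈ minCuts G) (hne : S' ≠ S) :
    (dependentSets G S' \ dependentSets G S).Nonempty := by
  by_contra hcon
  rw [Set.not_nonempty_iff_eq_empty, Set.sdiff_eq_empty] at hcon
  have hsub : S' ⊆ S := fun i hi =>
    singleton_mem_dependentSets.1 (hcon (singleton_mem_dependentSets.2 hi))
  obtain ⟨i, hi, hi'⟩ := Finset.exists_of_ssubset (lt_of_le_of_ne hsub hne)
  obtain ⟨a, ha, b, hb, hia, hib, hab⟩ := exists_separated_neighbours hS hi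
  have hsub' : Sᶜ ⊆ S'ᶜ := Finset.compl_subset_compl.2 hsub
  have hi'' : i ∈ S'ᶜ := by simpa using hi'
  have hl : Linked G S'ᶜ a b :=
    (Linked.of_adj (hsub' ha) hi'' hia.symm).trans (Linked.of_adj hi'' (hsub' hb) hib)
  have hne' : a ≠ b := by
    rintro rfl
    exact hab (Linked.refl ha)
  have := hcon ((pair_mem_dependentSets hne').2 (Or.inr (Or.inr hl)))
  rw [pair_mem_dependentSets hne'] at this
  rcases this with h | h | h
  · exact absurd h (by simpa using ha)
  · exact absurd h (by simpa using hb)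
  · exact hab h

lemma not_primeIdeal_le (hS : S ∈ minCuts G) (hne : S' ≠ S) :
    ¬ primeIdeal G S' ≤ primeIdeal G S := by
  intro hle
  obtain ⟨B, hB⟩ := sdiff_dependentSets_nonempty hS hne
  rcases eq_singleton_or_pair_of_mem_sdiff hB with ⟨i, rfl⟩ | ⟨i, j, hij, rfl⟩
  · rw [Set.mem_sdiff, singleton_mem_dependentSets, singleton_mem_dependentSets] at hB
    exact hB.2 (x_mem_primeIdeal.1 (hle (x_mem_primeIdeal.2 hB.1)))
  · rw [Set.mem_sdiff, pair_mem_dependentSets hij.ne, pair_mem_dependentSets hij.ne] at hB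
    exact hB.2 (f_mem_primeIdeal.1 (hle (f_mem_primeIdeal.2 hB.1)))

/-! ### The primary decomposition of `J_G` -/

/-- Vertices of `S` that are not cut points can be dropped from `S`, which shrinks `P_S`. -/
lemma exists_minCuts_primeIdeal_le (G : SimpleGraph (Fin n)) (S : Finset (Fin n)) :
    ∃ S' ∈ minCuts G, primeIdeal G S' ≤ primeIdeal G S := by
  induction S using Finset.strongInduction with
  | H S ih =>
    by_cases h : ∀ i ∈ S, IsCutPoint G (Sᶜ ∪ {i}) i
    · refine ⟨S, ?_, le_rfl⟩
      rcases S.eq_empty_or_nonempty with rfl | ⟨i, hi⟩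
      · exact Or.inr rfl
      have hlt := (h i hi).2
      rw [compl_union_singleton_sdiff hi] at hlt
      have hpos : 0 < numComponents G (Sᶜ ∪ {i}) := by
        have : Nonempty (Component G (Sᶜ ∪ {i})) :=
          ⟨(G.induce _).connectedComponentMk ⟨i, by simp⟩⟩
        exact Nat.card_pos
      obtain ⟨a, ha, -⟩ := (isCutPoint_iff hi).1 (h i hi)
      refine Or.inl ⟨numComponents G Sᶜ, by omega, ⟨i, hi⟩, ?_, rfl, h⟩
      rintro rfl
      simp at ha
    · push Not at h
      obtain ⟨i, hi, hcut⟩ := h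
      rw [isCutPoint_iff hi] at hcut
      push Not at hcut
      obtain ⟨S', hS', hle⟩ := ih (S.erase i) (Finset.erase_ssubset hi)
      refine ⟨S', hS', hle.trans (primeIdeal_le.2 ⟨fun j hj => ?_, fun j k hjk => ?_⟩)⟩
      · exact ⟨x_mem_primeIdeal.2 (Finset.mem_of_mem_erase hj),
          y_mem_primeIdeal.2 (Finset.mem_of_mem_erase hj)⟩
      · rw [f_mem_primeIdeal]
        by_cases hj : j ∈ S
        · exact Or.inl hj
        by_cases hk : k ∈ S
        · exact Or.inr (Or.inl hk)
        rw [Finset.compl_erase, Finset.insert_eq, Finset.union_comm] at hjk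
        exact Or.inr (Or.inr (Linked.of_union_singleton hcut (by simpa using hj)
          (by simpa using hk) (by simpa using hi) hjk))

/-- With `S` the set of vertices both of whose variables lie in `Q`, membership of the minors in
`Q` propagates along the walks of `G - S`. -/
lemma exists_minCuts_le_of_isPrime {Q : Ideal (PolyRing n)} (hQ : Q.IsPrime)
    (hle : edgeIdeal G ≤ Q) : ∃ S ∈ minCuts G, primeIdeal G S ≤ Q := by
  classical
  set S : Finset (Fin n) := Finset.univ.filter fun i => x i ∈ Q ∧ y i ∈ Q with hS
  obtain ⟨S', hS', h⟩ := exists_minCuts_primeIdeal_le G S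
  refine ⟨S', hS', h.trans (primeIdeal_le.2 ⟨fun i hi => by simpa [hS] using hi,
    fun i j hij => ?_⟩)⟩
  refine hij.induction (motive := fun j => f i j ∈ Q) (by simp [f]) ?_
  intro a ha b _ hab hia
  have hfab : f a b ∈ Q := by
    rw [edgeIdeal_eq_cutIdeal] at hle
    exact hle (f_mem_cutIdeal (Or.inr hab))
  have ha' : ¬ (x a ∈ Q ∧ y a ∈ Q) := by simpa [hS] using ha
  by_cases hx : x a ∈ Q
  · have hm : y a * f i b ∈ Q := by
      have : y a * f i b = y i * f a b + y b * f i a := by simp only [f]; ring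
      rw [this]
      exact add_mem (Q.mul_mem_left _ hfab) (Q.mul_mem_left _ hia)
    exact (hQ.mem_or_mem hm).resolve_left fun hy => ha' ⟨hx, hy⟩
  · have hm : x a * f i b ∈ Q := by
      have : x a * f i b = x i * f a b + x b * f i a := by simp only [f]; ring
      rw [this]
      exact add_mem (Q.mul_mem_left _ hfab) (Q.mul_mem_left _ hia)
    exact (hQ.mem_or_mem hm).resolve_left hx

/-- `J_G` is the intersection of the primes `P_S` with `S ∈ min(G)`. -/
theorem mem_edgeIdeal_iff {p : PolyRing n} :
    p ∈ edgeIdeal G ↔ ∀ S ∈ minCuts G, p ∈ primeIdeal G S := by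
  refine ⟨fun h S _ => edgeIdeal_le_primeIdeal G S h, fun h => ?_⟩
  rw [← (edgeIdeal_isRadical G).radical, Ideal.radical_eq_sInf, Ideal.mem_sInf]
  rintro Q ⟨hle, hQ⟩
  obtain ⟨S, hS, hSQ⟩ := exists_minCuts_le_of_isPrime hQ hle
  exact hSQ (h S hS)

/-! ### Polynomials whose colon ideal is `P_S` -/

/-- The polynomials that cut out `P_S` are those that lie in all the other minimal primes. -/
lemma colon_edgeIdeal_eq_iff {h : PolyRing n} :
    (edgeIdeal G).colon {h} = primeIdeal G S ↔
      h ∉ primeIdeal G S ∧ ∀ S' ∈ minCuts G, S' ≠ S → h ∈ primeIdeal G S' := by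
  constructor
  · intro heq
    have hother : ∀ S' ∈ minCuts G, S' ≠ S → h ∈ primeIdeal G S' := by
      intro S' hS' hne
      obtain ⟨p, hp, hp'⟩ := SetLike.not_le_iff_exists.1 (not_primeIdeal_le hS' hne.symm)
      rw [← heq, Submodule.mem_colon_singleton, smul_eq_mul] at hp
      exact ((primeIdeal_isPrime G S').mem_or_mem
        (edgeIdeal_le_primeIdeal G S' hp)).resolve_left hp'
    refine ⟨fun hh => ?_, hother⟩
    have hmem : h ∈ edgeIdeal G := by
      refine mem_edgeIdeal_iff.2 fun S' hS' => ?_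
      by_cases hne : S' = S
      · rwa [hne]
      · exact hother S' hS' hne
    refine (Ideal.ne_top_iff_one _).1 (primeIdeal_isPrime G S).ne_top ?_
    rw [← heq, Submodule.mem_colon_singleton, one_smul]
    exact hmem
  · rintro ⟨hh, hother⟩
    ext p
    rw [Submodule.mem_colon_singleton, smul_eq_mul]
    refine ⟨fun hp => ((primeIdeal_isPrime G S).mem_or_mem
      (edgeIdeal_le_primeIdeal G S hp)).resolve_right hh, fun hp => ?_⟩
    refine mem_edgeIdeal_iff.2 fun S' hS' => ?_
    by_cases hne : S' = S
    · rw [hne]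
      exact Ideal.mul_mem_right _ _ hp
    · exact Ideal.mul_mem_left _ _ (hother S' hS' hne)

/-! ### The polynomials `g_{A,C,D}` -/

variable {A : Finset (Finset (Fin n))} {C D : Finset (Fin n)}

lemma g_notMem {Q : Ideal (PolyRing n)} (hQ : Q.IsPrime) (hC : ∀ k ∈ C, x k ∉ Q)
    (hD : ∀ k ∈ D, y k ∉ Q) (hA : ∀ i j, i < j → {i, j} ∈ A → f i j ∉ Q) : g A C D ∉ Q := by
  intro h
  rw [g] at h
  rcases hQ.mem_or_mem h with h | h
  · rcases hQ.mem_or_mem h with h | h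
    · obtain ⟨k, hk, hmem⟩ := hQ.prod_mem_iff.1 h
      exact hC k hk hmem
    · obtain ⟨k, hk, hmem⟩ := hQ.prod_mem_iff.1 h
      exact hD k hk hmem
  · obtain ⟨p, hp, hmem⟩ := hQ.prod_mem_iff.1 h
    simp only [Finset.mem_filter, part2] at hp
    exact hA p.1 p.2 hp.2.1 hp.2.2.1 hmem

/-- Each pair in `A_2` is counted once, with its members in increasing order. -/
lemma card_pairs_eq (A : Finset (Finset (Fin n))) :
    ((Finset.univ : Finset (Fin n × Fin n)).filter
      (fun p => p.1 < p.2 ∧ {p.1, p.2} ∈ part2 A)).card = (part2 A).card := by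
  refine Finset.card_bij (fun p _ => {p.1, p.2}) (fun p hp => (Finset.mem_filter.1 hp).2.2) ?_ ?_
  · rintro ⟨i, j⟩ hp ⟨i', j'⟩ hp' heq
    have h₁ := (Finset.mem_filter.1 hp).2.1
    have h₂ := (Finset.mem_filter.1 hp').2.1
    simp only at h₁ h₂ heq
    have hi : i ∈ ({i', j'} : Finset (Fin n)) := heq ▸ (by simp)
    have hj : j ∈ ({i', j'} : Finset (Fin n)) := heq ▸ (by simp)
    rw [Finset.mem_insert, Finset.mem_singleton] at hi hj
    rw [Prod.mk.injEq]
    omega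
  · intro B hB
    obtain ⟨i, j, hij, rfl⟩ := Finset.card_eq_two.1 (Finset.mem_filter.1 hB).2
    rcases lt_or_gt_of_ne hij with h | h
    · exact ⟨(i, j), by simp [h, hB], rfl⟩
    · rw [Finset.pair_comm] at hB ⊢
      exact ⟨(j, i), by simp [h, hB], rfl⟩

lemma f_isHomogeneous (i j : Fin n) : (f i j).IsHomogeneous 2 :=
  ((isHomogeneous_X ℂ _).mul (isHomogeneous_X ℂ _)).sub
    ((isHomogeneous_X ℂ _).mul (isHomogeneous_X ℂ _))

lemma g_isHomogeneous (hdisj : Disjoint C D) (hCD : C ∪ D = part1 A) :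
    (g A C D).IsHomogeneous ((part1 A).card + 2 * (part2 A).card) := by
  rw [← hCD, Finset.card_union_of_disjoint hdisj, ← card_pairs_eq A]
  have h₁ := IsHomogeneous.prod C (fun k => (x k : PolyRing n)) (fun _ => 1)
    fun k _ => isHomogeneous_X ℂ _
  have h₂ := IsHomogeneous.prod D (fun k => (y k : PolyRing n)) (fun _ => 1)
    fun k _ => isHomogeneous_X ℂ _
  have h₃ := IsHomogeneous.prod ((Finset.univ : Finset (Fin n × Fin n)).filter
      (fun p => p.1 < p.2 ∧ {p.1, p.2} ∈ part2 A)) (fun p => (f p.1 p.2 : PolyRing n))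
    (fun _ => 2) fun p _ => f_isHomogeneous p.1 p.2
  simp only [Finset.sum_const, smul_eq_mul, mul_one] at h₁ h₂ h₃
  rw [mul_comm 2]
  exact (h₁.mul h₂).mul h₃

lemma transversals_nonempty (hS : S ∈ minCuts G) : (transversals G S).Nonempty := by
  classical
  refine ⟨Finset.univ.filter (· ∈ ⋃₀ Delta G S), fun B hB => by simpa using hB, ?_⟩
  rintro e ⟨S', hS', rfl⟩
  obtain ⟨B, hB⟩ := sdiff_dependentSets_nonempty hS (S' := S') hS'.2
  refine ⟨B, ?_, hB⟩
  rw [Finset.mem_coe, Finset.mem_filter]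
  exact ⟨Finset.mem_univ _, _, ⟨S', hS', rfl⟩, hB⟩

lemma notMem_dependentSets_of_transversal (hA : A ∈ transversals G S) {B : Finset (Fin n)}
    (hB : B ∈ A) : B ∉ dependentSets G S := by
  obtain ⟨_, ⟨S', -, rfl⟩, h⟩ := hA.1 hB
  exact h.2

/-- Every transversal `A` has a polynomial that cuts out `P_S`; `C = A_1`, `D = ∅` is one choice. -/
lemma colon_g_eq (hA : A ∈ transversals G S) :
    (edgeIdeal G).colon {g A (part1 A) ∅} = primeIdeal G S := by
  rw [colon_edgeIdeal_eq_iff]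
  constructor
  · refine g_notMem (primeIdeal_isPrime G S) (fun k hk hmem => ?_) (by simp)
      (fun i j hij hmem hf => ?_)
    · exact notMem_dependentSets_of_transversal hA (Finset.mem_filter.1 hk).2
        (singleton_mem_dependentSets.2 (x_mem_primeIdeal.1 hmem))
    · exact notMem_dependentSets_of_transversal hA hmem
        ((pair_mem_dependentSets hij.ne).2 (f_mem_primeIdeal.1 hf))
  · intro S' hS' hne
    obtain ⟨B, hBA, hB⟩ := hA.2 _ ⟨S', ⟨hS', hne⟩, rfl⟩
    rcases eq_singleton_or_pair_of_mem_sdiff hB with ⟨i, rfl⟩ | ⟨i, j, hij, rfl⟩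
    · have hx : x i ∈ primeIdeal G S' :=
        x_mem_primeIdeal.2 (singleton_mem_dependentSets.1 hB.1)
      refine Ideal.mul_mem_right _ _ (Ideal.mul_mem_right _ _ (Ideal.mem_of_dvd _
        (Finset.dvd_prod_of_mem (fun k => (x k : PolyRing n)) ?_) hx))
      exact Finset.mem_filter.2 ⟨Finset.mem_univ i, hBA⟩
    · have hf : f i j ∈ primeIdeal G S' :=
        f_mem_primeIdeal.2 ((pair_mem_dependentSets hij.ne).1 hB.1)
      refine Ideal.mul_mem_left _ _ (Ideal.mem_of_dvd _
        (Finset.dvd_prod_of_mem (fun p : Fin n × Fin n => (f p.1 p.2 : PolyRing n))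
          (a := (i, j)) ?_) hf)
      exact Finset.mem_filter.2 ⟨Finset.mem_univ _, hij,
        Finset.mem_filter.2 ⟨hBA, Finset.card_pair hij.ne⟩⟩

/-! ### The lower bound -/

/-- If a prime `Q ⊇ P_S` contains none of the other minimal primes, then the generators of these
that are not in `Q` form a transversal whose polynomial is not in `Q`. -/
lemma exists_primeIdeal_le_of_transversalIdeal_le {Q : Ideal (PolyRing n)} (hQ : Q.IsPrime)
    (hSQ : primeIdeal G S ≤ Q) (hT : transversalIdeal G S ≤ Q) :
    ∃ S' ∈ minCuts G, S' ≠ S ∧ primeIdeal G S' ≤ Q := by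
  classical
  by_contra! hcon
  -- the singletons and pairs with some generator `x_i`, `y_i`, respectively `f_{i,j}`, outside `Q`
  let ok : Finset (Fin n) → Prop := fun B =>
    (∀ i, B = {i} → ¬ (x i ∈ Q ∧ y i ∈ Q)) ∧ ∀ i j, i < j → B = {i, j} → f i j ∉ Q
  let A : Finset (Finset (Fin n)) := Finset.univ.filter fun B => B ∈ ⋃₀ Delta G S ∧ ok B
  have hA : A ∈ transversals G S := by
    refine ⟨fun B hB => (Finset.mem_filter.1 hB).2.1, ?_⟩
    rintro e ⟨S', hS', rfl⟩
    suffices h : ∃ B ∈ dependentSets G S' \ dependentSets G S, ok B by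
      obtain ⟨B, hB, hok⟩ := h
      exact ⟨B, Finset.mem_filter.2 ⟨Finset.mem_univ B, ⟨_, ⟨S', hS', rfl⟩, hB⟩, hok⟩, hB⟩
    have hnle := hcon S' hS'.1 hS'.2
    rw [primeIdeal_le, not_and_or] at hnle
    rcases hnle with h | h
    · push Not at h
      obtain ⟨i, hi, hxy⟩ := h
      have hiS : i ∉ S := fun h => by
        exact hxy (hSQ (x_mem_primeIdeal.2 h)) (hSQ (y_mem_primeIdeal.2 h))
      refine ⟨{i}, ⟨singleton_mem_dependentSets.2 hi,
        fun h => hiS (singleton_mem_dependentSets.1 h)⟩, fun j hj => ?_, fun j k hjk hB => ?_⟩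
      · rw [← Finset.singleton_inj.1 hj, not_and]
        exact hxy
      · have := congrArg Finset.card hB
        rw [Finset.card_singleton, Finset.card_pair hjk.ne] at this
        omega
    · push Not at h
      obtain ⟨i, j, hij, hf⟩ := h
      have hne : i ≠ j := by
        rintro rfl
        exact hf (by simp [f])
      refine ⟨{i, j}, ⟨(pair_mem_dependentSets hne).2 (Or.inr (Or.inr hij)),
        fun h => hf (hSQ (f_mem_primeIdeal.2 ((pair_mem_dependentSets hne).1 h)))⟩,
        fun k hk => ?_, fun k l hkl hB => ?_⟩
      · have := congrArg Finset.card hk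
        rw [Finset.card_singleton, Finset.card_pair hne] at this
        omega
      · have hi : i ∈ ({k, l} : Finset (Fin n)) := hB ▸ (by simp)
        have hj : j ∈ ({k, l} : Finset (Fin n)) := hB ▸ (by simp)
        rw [Finset.mem_insert, Finset.mem_singleton] at hi hj
        rcases hi with rfl | rfl <;> rcases hj with rfl | rfl
        · exact absurd rfl hne
        · exact hf
        · rwa [f_swap j i, neg_mem_iff] at hf
        · exact absurd rfl hne
  have hg : g A ((part1 A).filter fun i => x i ∉ Q) ((part1 A).filter fun i => ¬ x i ∉ Q) ∉ Q := by
    refine g_notMem hQ (fun k hk => (Finset.mem_filter.1 hk).2) (fun k hk hy => ?_)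
      (fun i j hij hB => (Finset.mem_filter.1 hB).2.2.2 i j hij rfl)
    obtain ⟨hk, hx⟩ := Finset.mem_filter.1 hk
    have hkA : ({k} : Finset (Fin n)) ∈ A := (Finset.mem_filter.1 hk).2
    exact (Finset.mem_filter.1 hkA).2.2.1 k rfl ⟨not_not.1 hx, hy⟩
  exact hg (hT (Ideal.subset_span ⟨A, hA, _, _, Finset.disjoint_filter_filter_not _ _ _,
    Finset.filter_union_filter_not_eq _ _, rfl⟩))

/-- The intersection of the other minimal primes lies in the radical of `J_G + J_T`. -/
lemma mem_radical_sup_transversalIdeal {h : PolyRing n}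
    (hh : ∀ S' ∈ minCuts G, S' ≠ S → h ∈ primeIdeal G S') :
    h ∈ (edgeIdeal G + transversalIdeal G S).radical := by
  rw [Ideal.radical_eq_sInf, Ideal.mem_sInf]
  rintro Q ⟨hle, hQ⟩
  rw [Submodule.add_eq_sup, sup_le_iff] at hle
  obtain ⟨S₁, hS₁, hle₁⟩ := exists_minCuts_le_of_isPrime hQ hle.1
  by_cases hne : S₁ = S
  · subst hne
    obtain ⟨S', hS', hne', hle'⟩ := exists_primeIdeal_le_of_transversalIdeal_le hQ hle₁ hle.2
    exact hle' (hh S' hS' hne')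
  · exact hle₁ (hh S₁ hS₁ hne)

section Degree

attribute [local instance] MvPolynomial.gradedAlgebra

lemma edgeIdeal_isHomogeneous (G : SimpleGraph (Fin n)) :
    (edgeIdeal G).IsHomogeneous (homogeneousSubmodule (Fin n ⊕ Fin n) ℂ) := by
  refine Ideal.homogeneous_span _ _ ?_
  rintro _ ⟨i, j, -, -, rfl⟩
  exact ⟨2, f_isHomogeneous i j⟩

lemma coeff_eq_zero_of_mem_span {σ : Type*} {T : Set (MvPolynomial σ ℂ)} {d : ℕ}
    (hT : ∀ t ∈ T, ∃ e, d < e ∧ t.IsHomogeneous e) {b : MvPolynomial σ ℂ}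
    (hb : b ∈ Ideal.span T) : ∀ s : σ →₀ ℕ, s.degree ≤ d → b.coeff s = 0 := by
  classical
  induction hb using Submodule.span_induction with
  | mem t ht =>
    intro s hs
    obtain ⟨e, he, hte⟩ := hT t ht
    exact hte.coeff_eq_zero (by omega)
  | zero => simp
  | add p q _ _ hp hq =>
    intro s hs
    rw [coeff_add, hp s hs, hq s hs, add_zero]
  | smul c p _ hp =>
    intro s hs
    rw [smul_eq_mul, coeff_mul]
    refine Finset.sum_eq_zero fun u hu => ?_
    rw [← Finset.HasAntidiagonal.mem_antidiagonal.1 hu, map_add] at hs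
    rw [hp u.2 (by omega), mul_zero]

/-- Generators of degree larger than `d` do not contribute to the degree `d` part of an ideal. -/
lemma mem_of_mem_sup_span {σ : Type*} {I : Ideal (MvPolynomial σ ℂ)}
    (hI : I.IsHomogeneous (homogeneousSubmodule σ ℂ)) {T : Set (MvPolynomial σ ℂ)} {d : ℕ}
    (hT : ∀ t ∈ T, ∃ e, d < e ∧ t.IsHomogeneous e) {h : MvPolynomial σ ℂ}
    (hh : h.IsHomogeneous d) (hmem : h ∈ I ⊔ Ideal.span T) : h ∈ I := by
  classical
  obtain ⟨a, ha, b, hb, rfl⟩ := Submodule.mem_sup.1 hmem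
  have hb0 : homogeneousComponent d b = 0 := by
    ext s
    rw [coeff_homogeneousComponent, coeff_zero]
    split_ifs with hs
    · exact coeff_eq_zero_of_mem_span hT hb s hs.le
    · rfl
  rw [← homogeneousComponent_eq_self hh, map_add, hb0, add_zero]
  exact homogeneousComponent_mem_of_mem hI ha d

end Degree

/-- When `J_G + J_T` is radical, a polynomial cutting out `P_S` lies in it but not in `J_G`, so its
degree is at least that of some generator of `J_T`. -/
lemma sInf_transversalWeights_le (hrad : (edgeIdeal G + transversalIdeal G S).IsRadical) {d : ℕ}
    (hd : d ∈ vDegrees (edgeIdeal G) (primeIdeal G S)) : sInf (transversalWeights G S) ≤ d := by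
  obtain ⟨h, hh, hcolon⟩ := hd
  obtain ⟨hnot, hother⟩ := colon_edgeIdeal_eq_iff.1 hcolon
  have hmem := mem_radical_sup_transversalIdeal hother
  rw [hrad.radical] at hmem
  by_contra! hlt
  refine hnot (edgeIdeal_le_primeIdeal G S
    (mem_of_mem_sup_span (edgeIdeal_isHomogeneous G) ?_ hh hmem))
  rintro _ ⟨A, hA, C, D, hdisj, hCD, rfl⟩
  exact ⟨_, hlt.trans_le (Nat.sInf_le ⟨A, hA, rfl⟩), g_isHomogeneous hdisj hCD⟩

end BinomialEdge

end

theorem theorem3p4 (n : ℕ) (G : SimpleGraph (Fin n)) (hG : G.Connected)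
    (S : Finset (Fin n)) (hS : S ∈ BinomialEdge.minCuts G) :
    (BinomialEdge.vDegrees (BinomialEdge.edgeIdeal G) (BinomialEdge.primeIdeal G S)).Nonempty ∧
    (BinomialEdge.transversalWeights G S).Nonempty ∧
    BinomialEdge.vNumber (BinomialEdge.edgeIdeal G) (BinomialEdge.primeIdeal G S) ≤
      sInf (BinomialEdge.transversalWeights G S) ∧
    ((BinomialEdge.edgeIdeal G + BinomialEdge.transversalIdeal G S).IsRadical →
      BinomialEdge.vNumber (BinomialEdge.edgeIdeal G) (BinomialEdge.primeIdeal G S) =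
        sInf (BinomialEdge.transversalWeights G S)) := by
  obtain ⟨A₀, hA₀⟩ := BinomialEdge.transversals_nonempty hS
  have hne : (BinomialEdge.transversalWeights G S).Nonempty := ⟨_, A₀, hA₀, rfl⟩
  obtain ⟨A, hA, hw⟩ := Nat.sInf_mem hne
  have hdeg : sInf (BinomialEdge.transversalWeights G S) ∈
      BinomialEdge.vDegrees (BinomialEdge.edgeIdeal G) (BinomialEdge.primeIdeal G S) := by
    rw [hw]
    exact ⟨_, BinomialEdge.g_isHomogeneous (Finset.disjoint_empty_right _)
      (Finset.union_empty _), BinomialEdge.colon_g_eq hA⟩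
  refine ⟨⟨_, hdeg⟩, hne, Nat.sInf_le hdeg, fun hrad => le_antisymm (Nat.sInf_le hdeg) ?_⟩
  exact BinomialEdge.sInf_transversalWeights_le hrad (Nat.sInf_mem ⟨_, hdeg⟩)
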